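/- Let $n,m\ge 0$ and $d\ge 1$ be integers. A $D$-dimensional one-way quantum protocol for inputs $x\in\{0,1\}^n$, $y\in\{0,1\}^m$ consists of maps $x\mapsto\rho_x$ and $y\mapsto E_y$, where each $\rho_x$ is a density matrix on $\mathbb{C}^D$ (positive semidefinite of trace $1$) and each $E_y$ is a $D\times D$ matrix with $0\le E_y\le I$. On inputs $x,y$, Alice sends $\rho_x$ to Bob, who measures the POVM $(E_{y1},E_{y2})=(E_y,I-E_y)$ and outputs $1$ with probability $\mathrm{tr}(\rho_xE_y)$ and $0$ with probability $\mathrm{tr}(\rho_x(I-E_y))$. The protocol computes $f:\{0,1\}^n\times\{0,1\}^m\to\{0,1\}$ with (worst-case) error at most $\varepsilon$ if for all $x,y$ the probability that the output differs from $f(x,y)$ is at most $\varepsilon$. Let $(\rho_x)_x,(E_y)_y$ be a $D$-dimensional one-way quantum protocol that computes a Boolean function $f:\{0,1\}^n\times\{0,1\}^m\to\{0,1\}$ with error at most $\varepsilon_0$, and put $$r=\max_{y\in\{0,1\}^m}\ \min_{z\in\{1,2\}}\ \mathrm{rank}\,E_{yz}.$$ Let $\varepsilon_1>0$ and suppose that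 $$d\ \ge\ \frac{1280000\,r^2}{\varepsilon_1^2}\,\max\bigl(\ln(4(2^n+2^{m+1})D),\ r\bigr).$$ Then there is a $d$-dimensional one-way quantum protocol that computes $f$ with worst-case error at most $\varepsilon_0+\varepsilon_1$. -/

import Mathlib

open scoped ComplexOrder

/-- A density matrix on `ℂ^d`: a positive semidefinite matrix of trace one. -/
def IsDensityMatrix {d : ℕ} (ρ : Matrix (Fin d) (Fin d) ℂ) : Prop :=
  ρ.PosSemidef ∧ ρ.trace = 1

/-- A `d`-dimensional one-way quantum protocol for inputs `x ∈ {0,1}^n` (Alice) and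
`y ∈ {0,1}^m` (Bob): Alice sends the state `ρ x`, and Bob measures it with the
binary POVM `(E y, 1 - E y)`. -/
structure OneWayProtocol (n m d : ℕ) where
  ρ : (Fin n → Bool) → Matrix (Fin d) (Fin d) ℂ
  E : (Fin m → Bool) → Matrix (Fin d) (Fin d) ℂ
  isDensityMatrix_ρ : ∀ x, IsDensityMatrix (ρ x)
  posSemidef_E : ∀ y, (E y).PosSemidef
  posSemidef_one_sub_E : ∀ y, (1 - E y).PosSemidef

namespace OneWayProtocol

variable {n m d : ℕ}

/-- The element of Bob's POVM on input `y` upon which he outputs the bit `a`: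
`E y` for output `1` and `1 - E y` for output `0`. -/
def povm (P : OneWayProtocol n m d) (y : Fin m → Bool) (a : Bool) :
    Matrix (Fin d) (Fin d) ℂ :=
  if a then P.E y else 1 - P.E y

/-- The probability `tr (ρ_x E_{y,a})` that Bob outputs `a` on inputs `x`, `y`
(the trace is real, as both matrices are positive semidefinite). -/
noncomputable def outputProb (P : OneWayProtocol n m d)
    (x : Fin n → Bool) (y : Fin m → Bool) (a : Bool) : ℝ :=
  (P.ρ x * P.povm y a).trace.re

/-- The protocol computes `f` with worst-case error at most `ε`: on every pair of inputs
the probability of the wrong output `1 - f(x,y)` is at most `ε`. -/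
def ComputesWithError (P : OneWayProtocol n m d)
    (f : (Fin n → Bool) → (Fin m → Bool) → Bool) (ε : ℝ) : Prop :=
  ∀ x y, P.outputProb x y (!f x y) ≤ ε

/-- `max_y min_z rank E_{yz}`. -/
noncomputable def maxMinRank (P : OneWayProtocol n m d) : ℕ :=
  Finset.univ.sup' Finset.univ_nonempty fun y : Fin m → Bool =>
    Finset.univ.inf' Finset.univ_nonempty fun z : Bool => (P.povm y z).rank

end OneWayProtocol

/-! For each `y` keep only the POVM element of smaller rank, of rank at most `r`. In eigenbases `u`,
`v` of the state and of this effect, the outcome probability is `∑ p i * l j * |⟨u i, v j⟩|²`, so it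
depends on the eigenvectors only through their inner products. A Johnson–Lindenstrauss matrix `G`
nearly preserves all inner products among these finitely many eigenvectors; the new protocol uses `G
ρ Gᴴ` divided by its trace and `G F Gᴴ / (1 + η)`.

The errors scale with `∑ l ≤ rank F ≤ r`, not with `D`: this holds for the change in probability
(`abs_weighted_sum_norm_sq_sub_le`) and for the excess of `G F Gᴴ` over the identity
(`Matrix.posSemidef_sub_mul_diagonal_mul_conjTranspose`). Accuracy of order `ε₁ / r` therefore
suffices, whence `d` of order `r² / ε₁²` times a logarithm.

`G` is a random sign matrix over `√d`. Probabilities are normalised sums over sign patterns, and a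
good `G` is found by a Chernoff bound resting on `sum_exp_mul_rademacherSum_sq_sub_le`. -/

/-! ### Exponential moments of Rademacher sums and their squares. -/

/-- The sign `±1` encoded by a bit. -/
def boolSign (b : Bool) : ℝ := if b then 1 else -1

/-- The Rademacher sum with coefficients `a` at the sign pattern `σ`. -/
noncomputable def rademacherSum {D : ℕ} (a : Fin D → ℝ) (σ : Fin D → Bool) : ℝ :=
  ∑ j, a j * boolSign (σ j)

theorem boolSign_mul_self (b : Bool) : boolSign b * boolSign b = 1 := by
  cases b <;> simp [boolSign]

theorem boolSign_not (b : Bool) : boolSign (!b) = -boolSign b := by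
  cases b <;> simp [boolSign]

theorem sum_exp_rademacherSum_le {D : ℕ} (a : Fin D → ℝ) (t : ℝ) :
    ∑ σ, Real.exp (t * rademacherSum a σ) ≤ 2 ^ D * Real.exp (t ^ 2 / 2 * ∑ j, a j ^ 2) := by
  have h1 : ∑ σ, Real.exp (t * rademacherSum a σ)
      = ∏ j, ∑ b : Bool, Real.exp (t * (a j * boolSign b)) := by
    rw [Finset.prod_univ_sum]
    simp only [Fintype.piFinset_univ]
    refine Finset.sum_congr rfl fun σ _ => ?_
    rw [rademacherSum, Finset.mul_sum, Real.exp_sum]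
  have h2 : ∀ j, ∑ b : Bool, Real.exp (t * (a j * boolSign b))
      ≤ 2 * Real.exp (t ^ 2 / 2 * a j ^ 2) := by
    intro j
    have := Real.cosh_le_exp_half_sq (t * a j)
    rw [Real.cosh_eq] at this
    simp only [Fintype.sum_bool, boolSign, if_true, mul_one, mul_neg, Bool.false_eq_true, if_false]
    have e : (t * a j) ^ 2 / 2 = t ^ 2 / 2 * a j ^ 2 := by ring
    rw [e] at this
    linarith
  rw [h1]
  calc _ ≤ ∏ j : Fin D, 2 * Real.exp (t ^ 2 / 2 * a j ^ 2) :=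
        Finset.prod_le_prod (fun j _ => by positivity) fun j _ => h2 j
    _ = _ := by
        rw [Finset.prod_mul_distrib, ← Real.exp_sum, Finset.mul_sum]
        simp

theorem sum_boolSign_mul_boolSign {D : ℕ} (i j : Fin D) :
    ∑ σ : Fin D → Bool, boolSign (σ i) * boolSign (σ j) = if i = j then 2 ^ D else 0 := by
  split_ifs with h
  · subst h
    simp [boolSign_mul_self]
  -- Flipping the `i`-th sign negates every summand, so the sum equals its own negative.
  · have hinv : Function.Involutive fun σ : Fin D → Bool => Function.update σ i (!σ i) := by
      intro σ
      simp
    have := Equiv.sum_comp hinv.toPerm fun σ => boolSign (σ i) * boolSign (σ j)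
    simp only [Function.Involutive.coe_toPerm, Function.update_self, boolSign_not,
      Function.update_of_ne (Ne.symm h), neg_mul, Finset.sum_neg_distrib] at this
    linarith

theorem sum_rademacherSum_sq {D : ℕ} (a : Fin D → ℝ) :
    ∑ σ, rademacherSum a σ ^ 2 = 2 ^ D * ∑ j, a j ^ 2 := by
  have h : ∀ σ, rademacherSum a σ ^ 2
      = ∑ i, ∑ j, a i * a j * (boolSign (σ i) * boolSign (σ j)) := by
    intro σ
    rw [sq, rademacherSum, Finset.sum_mul_sum]
    exact Finset.sum_congr rfl fun i _ => Finset.sum_congr rfl fun j _ => by ring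
  simp_rw [h]
  rw [Finset.sum_comm, Finset.mul_sum]
  refine Finset.sum_congr rfl fun i _ => ?_
  rw [Finset.sum_comm]
  simp_rw [← Finset.mul_sum, sum_boolSign_mul_boolSign]
  simp
  ring

/-- Completing the square: a Gaussian average of exponentials. -/
theorem integrable_exp_gaussian_shift (c : ℝ) :
    MeasureTheory.Integrable fun z : ℝ => Real.exp (c * z - z ^ 2 / 2) := by
  have h := ((integrable_exp_neg_mul_sq (b := 1 / 2) (by norm_num)).comp_sub_right c).const_mul
    (Real.exp (c ^ 2 / 2))
  refine h.congr (Filter.Eventually.of_forall fun z => ?_)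
  simp only [← Real.exp_add]
  congr 1
  ring

theorem integral_exp_gaussian_shift (c : ℝ) :
    ∫ z : ℝ, Real.exp (c * z - z ^ 2 / 2) = Real.exp (c ^ 2 / 2) * √(2 * Real.pi) := by
  have h : ∀ z : ℝ, Real.exp (c * z - z ^ 2 / 2)
      = Real.exp (c ^ 2 / 2) * Real.exp (-(1 / 2) * (z - c) ^ 2) := by
    intro z
    rw [← Real.exp_add]
    congr 1
    ring
  simp_rw [h]
  rw [MeasureTheory.integral_const_mul,
    MeasureTheory.integral_sub_right_eq_self (fun z : ℝ => Real.exp (-(1 / 2) * z ^ 2)) c,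
    integral_gaussian]
  congr 2
  ring

/-- Gaussian linearisation: `exp (X² / 4)` is the mean of `exp (X z / √2)` over a standard Gaussian
`z`. Exchanging the averages and applying the subgaussian bound leaves the mean of `exp (z² / 4)`,
which is `√2`. -/
theorem sum_exp_rademacherSum_sq_le {D : ℕ} (a : Fin D → ℝ) (ha : ∑ j, a j ^ 2 ≤ 1) :
    ∑ σ, Real.exp (rademacherSum a σ ^ 2 / 4) ≤ 2 ^ D * √2 := by
  have hs : (1 / √2 : ℝ) ^ 2 = 1 / 2 := by
    rw [div_pow, Real.sq_sqrt (by norm_num)]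
    norm_num
  have hpos : 0 < √(2 * Real.pi) := by positivity
  have key : (∑ σ, Real.exp (rademacherSum a σ ^ 2 / 4)) * √(2 * Real.pi)
      ≤ 2 ^ D * √2 * √(2 * Real.pi) := by
    have e1 : ∀ σ, Real.exp (rademacherSum a σ ^ 2 / 4) * √(2 * Real.pi)
        = ∫ z : ℝ, Real.exp ((1 / √2 * rademacherSum a σ) * z - z ^ 2 / 2) := by
      intro σ
      rw [integral_exp_gaussian_shift, mul_pow, hs]
      congr 2
      ring
    rw [Finset.sum_mul]
    simp_rw [e1]
    rw [← MeasureTheory.integral_finsetSum _ fun σ _ => integrable_exp_gaussian_shift _]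
    have e2 : (2 : ℝ) ^ D * √2 * √(2 * Real.pi)
        = ∫ z : ℝ, 2 ^ D * Real.exp (-(1 / 4) * z ^ 2) := by
      rw [MeasureTheory.integral_const_mul, integral_gaussian, mul_assoc,
        ← Real.sqrt_mul (by norm_num)]
      congr 2
      ring
    rw [e2]
    refine MeasureTheory.integral_mono
      (MeasureTheory.integrable_finsetSum _ fun σ _ => integrable_exp_gaussian_shift _)
      ((integrable_exp_neg_mul_sq (by norm_num)).const_mul _) fun z => ?_
    have e3 : ∀ σ, Real.exp ((1 / √2 * rademacherSum a σ) * z - z ^ 2 / 2)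
        = Real.exp ((1 / √2 * z) * rademacherSum a σ) * Real.exp (-(z ^ 2 / 2)) := by
      intro σ
      rw [← Real.exp_add]
      congr 1
      ring
    simp only [e3]
    rw [← Finset.sum_mul]
    calc _ ≤ (2 ^ D * Real.exp ((1 / √2 * z) ^ 2 / 2 * ∑ j, a j ^ 2)) * Real.exp (-(z ^ 2 / 2)) :=
          mul_le_mul_of_nonneg_right (sum_exp_rademacherSum_le a _) (Real.exp_pos _).le
      _ = 2 ^ D * Real.exp (z ^ 2 / 4 * ∑ j, a j ^ 2 - z ^ 2 / 2) := by
          rw [mul_assoc, ← Real.exp_add, mul_pow, hs]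
          congr 2
          ring
      _ ≤ _ := by
          gcongr
          nlinarith [sq_nonneg z]
  exact le_of_mul_le_mul_right key hpos

theorem exp_le_one_add_add_sq_mul_exp_abs (y : ℝ) :
    Real.exp y ≤ 1 + y + y ^ 2 * Real.exp |y| := by
  have h := Complex.norm_exp_sub_sum_le_norm_mul_exp (y : ℂ) 2
  have e : Complex.exp y - ∑ m ∈ Finset.range 2, (y : ℂ) ^ m / (m.factorial : ℂ)
      = ((Real.exp y - (1 + y) : ℝ) : ℂ) := by
    simp [Finset.sum_range_succ]
  rw [e, Complex.norm_real, Complex.norm_real, Real.norm_eq_abs, Real.norm_eq_abs, sq_abs] at h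
  linarith [le_abs_self (Real.exp y - (1 + y))]

theorem sq_le_exp_sub_two {w : ℝ} (hw : 0 ≤ w) : w ^ 2 ≤ 4 * Real.exp (w - 2) := by
  have h : w ≤ 2 * Real.exp (w / 2 - 1) := by
    linarith [Real.add_one_le_exp (w / 2 - 1)]
  calc w ^ 2 ≤ (2 * Real.exp (w / 2 - 1)) ^ 2 := by gcongr
    _ = 4 * Real.exp (w - 2) := by
        rw [mul_pow, ← Real.exp_nat_mul]
        congr 1
        · norm_num
        · congr 1
          push_cast
          ring

/-- Second-order expansion of the exponential: the linear term averages to zero because `X²` has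
mean `∑ a j ^ 2`, and the remainder is dominated by a multiple of `exp (X² / 4)`. -/
theorem sum_exp_mul_rademacherSum_sq_sub_le {D : ℕ} (a : Fin D → ℝ) (ha : ∑ j, a j ^ 2 ≤ 1)
    {s : ℝ} (hs : |s| ≤ 1 / 8) :
    ∑ σ, Real.exp (s * (rademacherSum a σ ^ 2 - ∑ j, a j ^ 2))
      ≤ 2 ^ D * Real.exp (64 * s ^ 2) := by
  set v := ∑ j, a j ^ 2 with hv
  have hv0 : 0 ≤ v := Finset.sum_nonneg fun j _ => sq_nonneg _
  have hpt : ∀ σ, Real.exp (s * (rademacherSum a σ ^ 2 - v))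
      ≤ 1 + s * (rademacherSum a σ ^ 2 - v)
        + s ^ 2 * (256 * Real.exp (-(7 / 4))) * Real.exp (rademacherSum a σ ^ 2 / 4) := by
    intro σ
    set X2 := rademacherSum a σ ^ 2 with hX
    have hX0 : 0 ≤ X2 := sq_nonneg _
    set Z := X2 - v with hZ
    have hZabs : |Z| ≤ X2 + 1 := abs_le.2 ⟨by linarith, by linarith⟩
    have h1 := exp_le_one_add_add_sq_mul_exp_abs (s * Z)
    have h2 := sq_le_exp_sub_two (w := |Z| / 8) (by positivity)
    have h3 : Real.exp |s * Z| ≤ Real.exp (|Z| / 8) := by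
      rw [abs_mul]
      gcongr
      nlinarith [abs_nonneg Z]
    have h4 : Z ^ 2 * Real.exp |s * Z|
        ≤ 256 * Real.exp (-(7 / 4)) * Real.exp (X2 / 4) := by
      calc Z ^ 2 * Real.exp |s * Z| ≤ (256 * Real.exp (|Z| / 8 - 2)) * Real.exp (|Z| / 8) := by
            gcongr
            rw [← sq_abs]
            linarith
        _ = 256 * Real.exp (|Z| / 4 - 2) := by
            rw [mul_assoc, ← Real.exp_add]
            congr 2
            ring
        _ ≤ 256 * Real.exp (-(7 / 4) + X2 / 4) := by
            gcongr
            linarith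
        _ = _ := by rw [Real.exp_add, mul_assoc]
    calc _ ≤ 1 + s * Z + s ^ 2 * (Z ^ 2 * Real.exp |s * Z|) := by
          rw [mul_pow, mul_assoc] at h1
          exact h1
      _ ≤ 1 + s * Z + s ^ 2 * (256 * Real.exp (-(7 / 4)) * Real.exp (X2 / 4)) := by gcongr
      _ = _ := by ring
  -- Equivalent to `4√2 ≤ e^(7/4)`, or after fourth powers `1024 ≤ e^7`.
  have hconst : 256 * Real.exp (-(7 / 4)) * √2 ≤ 64 := by
    have h1 : 4 * √2 ≤ Real.exp (7 / 4) := by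
      refine le_of_pow_le_pow_left₀ (n := 4) (by norm_num) (Real.exp_pos _).le ?_
      rw [← Real.exp_nat_mul, mul_pow, show (√2) ^ 4 = ((√2) ^ 2) ^ 2 by ring,
        Real.sq_sqrt (by norm_num)]
      have h7 : Real.exp ((4 : ℕ) * (7 / 4)) = Real.exp 1 ^ 7 := by
        rw [← Real.exp_nat_mul]
        norm_num
      rw [h7]
      have := Real.exp_one_gt_d9
      calc (4 : ℝ) ^ 4 * 2 ^ 2 ≤ 2.71 ^ 7 := by norm_num
        _ ≤ _ := by gcongr; linarith
    calc 256 * Real.exp (-(7 / 4)) * √2 = 64 * (Real.exp (-(7 / 4)) * (4 * √2)) := by ring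
      _ ≤ 64 * (Real.exp (-(7 / 4)) * Real.exp (7 / 4)) := by gcongr
      _ = 64 := by rw [← Real.exp_add]; simp
  calc _ ≤ ∑ σ : Fin D → Bool, (1 + s * (rademacherSum a σ ^ 2 - v)
        + s ^ 2 * (256 * Real.exp (-(7 / 4))) * Real.exp (rademacherSum a σ ^ 2 / 4)) :=
        Finset.sum_le_sum fun σ _ => hpt σ
    _ = 2 ^ D + s ^ 2 * (256 * Real.exp (-(7 / 4)))
          * ∑ σ, Real.exp (rademacherSum a σ ^ 2 / 4) := by
        rw [Finset.sum_add_distrib, Finset.sum_add_distrib, ← Finset.mul_sum, ← Finset.mul_sum,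
          Finset.sum_sub_distrib, sum_rademacherSum_sq]
        simp [hv]
    _ ≤ 2 ^ D + s ^ 2 * (256 * Real.exp (-(7 / 4))) * (2 ^ D * √2) := by
        gcongr
        exact sum_exp_rademacherSum_sq_le a ha
    _ = 2 ^ D * (1 + s ^ 2 * (256 * Real.exp (-(7 / 4)) * √2)) := by ring
    _ ≤ 2 ^ D * (1 + s ^ 2 * 64) := by gcongr
    _ ≤ _ := by
        gcongr
        linarith [Real.add_one_le_exp (64 * s ^ 2)]

/-! ### Johnson–Lindenstrauss lemmas: norms, real and complex inner products, isometries. -/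

/-- Johnson–Lindenstrauss lemma for squared norms: for any finite family of vectors in the unit
ball some rescaled sign matrix preserves all the squared norms up to `δ`. -/
theorem exists_matrix_norm_sq_approx {κ : Type*} [Fintype κ] {d D : ℕ} (hd : 1 ≤ d)
    (q : κ → Fin D → ℝ) (hq : ∀ k, ∑ j, q k j ^ 2 ≤ 1) {δ : ℝ} (hδ : 0 < δ) (hδ1 : δ ≤ 1)
    (hcard : 2 * (Fintype.card κ : ℝ) < Real.exp (d * δ ^ 2 / 256)) :
    ∃ G : Matrix (Fin d) (Fin D) ℝ,
      ∀ k, |(G.mulVec (q k)) ⬝ᵥ (G.mulVec (q k)) - q k ⬝ᵥ q k| ≤ δ := by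
  have hd0 : (0 : ℝ) < d := by exact_mod_cast hd
  -- This minimises the Chernoff exponent `64 s² - s δ`; the minimum `-δ² / 256` is the rate in
  -- `hcard`.
  set s := δ / 128 with hs
  have hs0 : 0 < s := by positivity
  let Z : κ → (Fin d → Fin D → Bool) → ℝ := fun k g =>
    ∑ i, (rademacherSum (q k) (g i) ^ 2 - ∑ j, q k j ^ 2)
  have hmgf : ∀ k (t : ℝ), |t| ≤ 1 / 8 →
      ∑ g, Real.exp (t * Z k g) ≤ (2 ^ D) ^ d * Real.exp (d * (64 * t ^ 2)) := by
    intro k t ht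
    have : ∑ g, Real.exp (t * Z k g)
        = (∑ σ, Real.exp (t * (rademacherSum (q k) σ ^ 2 - ∑ j, q k j ^ 2))) ^ d := by
      rw [Fintype.sum_pow]
      refine Finset.sum_congr rfl fun g _ => ?_
      rw [Finset.mul_sum, Real.exp_sum]
    rw [this, Real.exp_nat_mul, ← mul_pow]
    exact pow_le_pow_left₀ (Finset.sum_nonneg fun _ _ => (Real.exp_pos _).le)
      (sum_exp_mul_rademacherSum_sq_sub_le (q k) (hq k) ht) d
  have hsabs : |s| ≤ 1 / 8 := by
    rw [abs_of_pos hs0, hs]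
    linarith
  -- Some sign matrix does no worse than average. Summing over `k` and both signs of `s` is the
  -- union bound over two-sided deviations.
  obtain ⟨g, -, hg⟩ : ∃ g ∈ (Finset.univ : Finset (Fin d → Fin D → Bool)),
      ∑ k, (Real.exp (s * Z k g) + Real.exp (-s * Z k g))
        ≤ 2 * Fintype.card κ * Real.exp (d * (64 * s ^ 2)) := by
    refine Finset.exists_le_of_sum_le Finset.univ_nonempty ?_
    rw [Finset.sum_comm]
    calc _ ≤ ∑ k : κ, 2 * ((2 ^ D) ^ d * Real.exp (d * (64 * s ^ 2))) := by
          refine Finset.sum_le_sum fun k _ => ?_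
          rw [Finset.sum_add_distrib]
          have h1 := hmgf k s hsabs
          have h2 := hmgf k (-s) (by rwa [abs_neg])
          rw [neg_sq] at h2
          linarith
      _ = _ := by
          simp
          ring
  have hlt : 2 * Fintype.card κ * Real.exp (d * (64 * s ^ 2)) < Real.exp (s * (d * δ)) := by
    calc _ < Real.exp (d * δ ^ 2 / 256) * Real.exp (d * (64 * s ^ 2)) := by gcongr
      _ = _ := by
          rw [← Real.exp_add, hs]
          congr 1
          ring
  have hZ : ∀ k, |Z k g| ≤ d * δ := by
    intro k
    have hk : Real.exp (s * Z k g) + Real.exp (-s * Z k g) < Real.exp (s * (d * δ)) :=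
      lt_of_le_of_lt (le_trans (Finset.single_le_sum
        (f := fun k => Real.exp (s * Z k g) + Real.exp (-s * Z k g))
        (fun _ _ => by positivity) (Finset.mem_univ k)) hg) hlt
    have h1 : Real.exp (s * Z k g) < Real.exp (s * (d * δ)) := by
      linarith [Real.exp_pos (-s * Z k g)]
    have h2 : Real.exp (-s * Z k g) < Real.exp (s * (d * δ)) := by
      linarith [Real.exp_pos (s * Z k g)]
    rw [Real.exp_lt_exp] at h1 h2
    rw [abs_le]
    constructor
    · have : s * (-Z k g) < s * (d * δ) := by linarith
      linarith [lt_of_mul_lt_mul_left this hs0.le]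
    · exact (lt_of_mul_lt_mul_left h1 hs0.le).le
  refine ⟨Matrix.of fun i j => boolSign (g i j) / √d, fun k => ?_⟩
  have hG : ∀ i, (Matrix.of fun i j => boolSign (g i j) / √d).mulVec (q k) i
      = rademacherSum (q k) (g i) / √d := by
    intro i
    simp only [Matrix.mulVec, dotProduct, Matrix.of_apply, rademacherSum, Finset.sum_div]
    exact Finset.sum_congr rfl fun j _ => by ring
  have hval : (Matrix.of fun i j => boolSign (g i j) / √d).mulVec (q k) ⬝ᵥ
      (Matrix.of fun i j => boolSign (g i j) / √d).mulVec (q k) - q k ⬝ᵥ q k = Z k g / d := by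
    simp only [Z]
    rw [dotProduct, Finset.sum_sub_distrib, sub_div, Finset.sum_div]
    congr 1
    · refine Finset.sum_congr rfl fun i _ => ?_
      rw [hG, div_mul_div_comm, Real.mul_self_sqrt hd0.le, sq]
    · simp only [dotProduct, Finset.sum_const, Finset.card_univ, Fintype.card_fin, nsmul_eq_mul]
      rw [mul_div_cancel_left₀ _ hd0.ne']
      exact Finset.sum_congr rfl fun i _ => (sq _).symm
  rw [hval, abs_div, abs_of_pos hd0, div_le_iff₀ hd0, mul_comm δ]
  exact hZ k

/-- Johnson–Lindenstrauss lemma for inner products. -/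
theorem exists_matrix_dotProduct_approx {ι : Type*} [Fintype ι] {d D : ℕ} (hd : 1 ≤ d)
    (p : ι → Fin D → ℝ) (hp : ∀ i, p i ⬝ᵥ p i ≤ 1) {δ : ℝ} (hδ : 0 < δ) (hδ1 : δ ≤ 1)
    (hcard : 4 * (Fintype.card ι : ℝ) ^ 2 < Real.exp (d * δ ^ 2 / 256)) :
    ∃ G : Matrix (Fin d) (Fin D) ℝ,
      ∀ i j, |(G.mulVec (p i)) ⬝ᵥ (G.mulVec (p j)) - p i ⬝ᵥ p j| ≤ 2 * δ := by
  -- Polarisation: the squared norms of `(p i + p j) / 2` and `(p i - p j) / 2` differ by the inner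
  -- product, and both vectors lie in the unit ball.
  let q : ι × ι × Bool → Fin D → ℝ := fun k =>
    (1 / 2 : ℝ) • (p k.1 + boolSign k.2.2 • p k.2.1)
  have hself : ∀ v : Fin D → ℝ, 0 ≤ v ⬝ᵥ v := fun v =>
    Finset.sum_nonneg fun i _ => mul_self_nonneg _
  have hq : ∀ k, ∑ j, q k j ^ 2 ≤ 1 := by
    rintro ⟨i, j, b⟩
    have e : ∑ l, q (i, j, b) l ^ 2 = q (i, j, b) ⬝ᵥ q (i, j, b) :=
      Finset.sum_congr rfl fun l _ => sq _
    have h1 := hp i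
    have h2 := hp j
    have h3 := hself (p i - p j)
    have h4 := hself (p i + p j)
    have hc := dotProduct_comm (p j) (p i)
    rw [e]
    simp only [add_dotProduct, dotProduct_add, sub_dotProduct, dotProduct_sub] at h3 h4
    cases b <;> simp only [q, boolSign, add_dotProduct, dotProduct_add, smul_dotProduct,
      dotProduct_smul, smul_eq_mul, if_true, Bool.false_eq_true, if_false] <;> linarith
  obtain ⟨G, hG⟩ := exists_matrix_norm_sq_approx hd q hq hδ hδ1 (by
    simp only [Fintype.card_prod, Fintype.card_bool]
    push_cast
    linarith)
  refine ⟨G, fun i j => ?_⟩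
  have h1 := hG (i, j, true)
  have h2 := hG (i, j, false)
  have hc := dotProduct_comm (p j) (p i)
  have hc' := dotProduct_comm (G.mulVec (p j)) (G.mulVec (p i))
  simp only [q, boolSign, Matrix.mulVec_smul, Matrix.mulVec_add, add_dotProduct, dotProduct_add,
    smul_dotProduct, dotProduct_smul, smul_eq_mul, if_true, Bool.false_eq_true, if_false,
    abs_le] at h1 h2
  rw [abs_le]
  constructor <;> linarith [h1.1, h1.2, h2.1, h2.2]

theorem dotProduct_star_self_eq {n : ℕ} (x : Fin n → ℂ) :
    star x ⬝ᵥ x = ((∑ i, ‖x i‖ ^ 2 : ℝ) : ℂ) := by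
  simp [dotProduct, Complex.conj_mul']

/-- Johnson–Lindenstrauss lemma for Hermitian inner products. -/
theorem exists_matrix_star_dotProduct_approx {A : Type*} [Fintype A] {d D : ℕ} (hd : 1 ≤ d)
    (t : A → Fin D → ℂ) (ht : ∀ a, ∑ j, ‖t a j‖ ^ 2 ≤ 1) {δ : ℝ} (hδ : 0 < δ) (hδ1 : δ ≤ 1)
    (hcard : 16 * (Fintype.card A : ℝ) ^ 2 < Real.exp (d * δ ^ 2 / 256)) :
    ∃ G : Matrix (Fin d) (Fin D) ℂ, ∀ a b,
      ‖star (G.mulVec (t a)) ⬝ᵥ G.mulVec (t b) - star (t a) ⬝ᵥ t b‖ ≤ 8 * δ := by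
  -- A real `G` acts separately on real and imaginary parts. Each part of a Hermitian product
  -- combines two real inner products, costing `4 * δ` per part.
  let p : A × Bool → Fin D → ℝ := fun k j => if k.2 then (t k.1 j).re else (t k.1 j).im
  have hp : ∀ k, p k ⬝ᵥ p k ≤ 1 := by
    rintro ⟨a, b⟩
    refine le_trans (Finset.sum_le_sum fun j _ => ?_) (ht a)
    rw [← Complex.normSq_eq_norm_sq, Complex.normSq_apply]
    cases b <;> simp [p, mul_self_nonneg]
  obtain ⟨G, hG⟩ := exists_matrix_dotProduct_approx hd p hp hδ hδ1 (by
    simp only [Fintype.card_prod, Fintype.card_bool]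
    push_cast
    linarith)
  have hGt : ∀ a i, (G.map (algebraMap ℝ ℂ)).mulVec (t a) i
      = ⟨G.mulVec (p (a, true)) i, G.mulVec (p (a, false)) i⟩ := by
    intro a i
    apply Complex.ext <;> simp [Matrix.mulVec, dotProduct, p]
  have hdot : ∀ {k : ℕ} (u v u' v' : Fin k → ℝ) (w z : Fin k → ℂ),
      (∀ i, w i = ⟨u i, v i⟩) → (∀ i, z i = ⟨u' i, v' i⟩) →
      star w ⬝ᵥ z = ⟨u ⬝ᵥ u' + v ⬝ᵥ v', u ⬝ᵥ v' - v ⬝ᵥ u'⟩ := by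
    intro k u v u' v' w z hw hz
    apply Complex.ext <;>
      simp [dotProduct, hw, hz, Finset.sum_add_distrib, sub_eq_add_neg]
  refine ⟨G.map (algebraMap ℝ ℂ), fun a b => ?_⟩
  rw [hdot _ _ _ _ _ _ (hGt a) (hGt b),
    hdot (p (a, true)) (p (a, false)) (p (b, true)) (p (b, false)) (t a) (t b)
      (fun i => by simp [p]) (fun i => by simp [p])]
  refine (Complex.norm_le_abs_re_add_abs_im _).trans ?_
  have h1 := abs_le.1 (hG (a, true) (b, true))
  have h2 := abs_le.1 (hG (a, false) (b, false))
  have h3 := abs_le.1 (hG (a, true) (b, false))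
  have h4 := abs_le.1 (hG (a, false) (b, true))
  have h5 : |(G.mulVec (p (a, true)) ⬝ᵥ G.mulVec (p (b, true))
      + G.mulVec (p (a, false)) ⬝ᵥ G.mulVec (p (b, false)))
      - (p (a, true) ⬝ᵥ p (b, true) + p (a, false) ⬝ᵥ p (b, false))| ≤ 4 * δ :=
    abs_le.2 ⟨by linarith [h1.1, h2.1], by linarith [h1.2, h2.2]⟩
  have h6 : |(G.mulVec (p (a, true)) ⬝ᵥ G.mulVec (p (b, false))
      - G.mulVec (p (a, false)) ⬝ᵥ G.mulVec (p (b, true)))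
      - (p (a, true) ⬝ᵥ p (b, false) - p (a, false) ⬝ᵥ p (b, true))| ≤ 4 * δ :=
    abs_le.2 ⟨by linarith [h3.1, h4.2], by linarith [h3.2, h4.1]⟩
  simp only [Complex.sub_re, Complex.sub_im]
  linarith

open Matrix in
/-- Johnson–Lindenstrauss lemma for the columns of finitely many isometries. -/
theorem exists_matrix_conjTranspose_mul_approx {C : Type*} [Fintype C] {d D : ℕ} (hd : 1 ≤ d)
    (W : C → Matrix (Fin D) (Fin D) ℂ) (hW : ∀ c, (W c)ᴴ * W c = 1) {δ : ℝ} (hδ : 0 < δ)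
    (hδ1 : δ ≤ 1)
    (hcard : 16 * ((Fintype.card C : ℝ) * D) ^ 2 < Real.exp (d * δ ^ 2 / 256)) :
    ∃ G : Matrix (Fin d) (Fin D) ℂ, ∀ c c' i j,
      ‖((G * W c)ᴴ * (G * W c')) i j - ((W c)ᴴ * W c') i j‖ ≤ 8 * δ := by
  have hdot : ∀ {k : ℕ} (X Y : Matrix (Fin k) (Fin D) ℂ) i j,
      (Xᴴ * Y) i j = star (fun l => X l i) ⬝ᵥ fun l => Y l j := by
    intro k X Y i j
    simp [Matrix.mul_apply, dotProduct]
  obtain ⟨G, hG⟩ := exists_matrix_star_dotProduct_approx (A := C × Fin D) hd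
    (fun a l => W a.1 l a.2) (fun a => by
      have := congrFun (congrFun (hW a.1) a.2) a.2
      rw [hdot, dotProduct_star_self_eq, Matrix.one_apply_eq] at this
      exact le_of_eq (by exact_mod_cast this)) hδ hδ1 (by
      simpa only [Fintype.card_prod, Fintype.card_fin, Nat.cast_mul] using hcard)
  refine ⟨G, fun c c' i j => ?_⟩
  have h := hG (c, i) (c', j)
  rw [hdot, hdot]
  exact h

/-! ### Traces, operator bounds and spectral decompositions. -/

open Matrix in
theorem Matrix.trace_mul_diagonal_mul_conjTranspose {m n : ℕ} (A : Matrix (Fin m) (Fin n) ℂ)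
    (p : Fin n → ℝ) :
    (A * diagonal (fun j => (p j : ℂ)) * Aᴴ).trace = ∑ j, (p j : ℂ) * (Aᴴ * A) j j := by
  rw [Matrix.trace_mul_comm, ← Matrix.mul_assoc, Matrix.trace]
  simp [Matrix.mul_diagonal, mul_comm]

open Matrix in
theorem Matrix.trace_mul_diagonal_conj_mul_diagonal_conj {m n : ℕ}
    (A B : Matrix (Fin m) (Fin n) ℂ) (p l : Fin n → ℝ) :
    ((A * diagonal (fun j => (p j : ℂ)) * Aᴴ) * (B * diagonal (fun j => (l j : ℂ)) * Bᴴ)).trace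
      = ((∑ i, ∑ j, p i * l j * ‖(Aᴴ * B) i j‖ ^ 2 : ℝ) : ℂ) := by
  have h1 : ((A * diagonal (fun j => (p j : ℂ)) * Aᴴ) *
      (B * diagonal (fun j => (l j : ℂ)) * Bᴴ)).trace
      = (diagonal (fun j => (p j : ℂ)) * (Aᴴ * B) *
          (diagonal (fun j => (l j : ℂ)) * (Aᴴ * B)ᴴ)).trace := by
    rw [Matrix.conjTranspose_mul, Matrix.conjTranspose_conjTranspose, Matrix.mul_assoc A,
      Matrix.mul_assoc A, Matrix.trace_mul_comm A]
    simp only [Matrix.mul_assoc]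
  rw [h1, Matrix.trace]
  simp only [Matrix.diag_apply, Matrix.mul_apply (M := _ * _), Matrix.diagonal_mul,
    Matrix.conjTranspose_apply]
  push_cast
  refine Finset.sum_congr rfl fun i _ => Finset.sum_congr rfl fun j _ => ?_
  rw [← Complex.mul_conj']
  simp only [RCLike.star_def]
  ring

open Matrix in
/-- If the columns of `B` are orthonormal up to `δ` then `B diag(l) Bᴴ ≤ 1 + δ ∑ l`. -/
theorem Matrix.posSemidef_sub_mul_diagonal_mul_conjTranspose {m n : ℕ}
    (B : Matrix (Fin m) (Fin n) ℂ) (l : Fin n → ℝ) (hl0 : ∀ i, 0 ≤ l i) (hl1 : ∀ i, l i ≤ 1)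
    {δ η : ℝ} (hB : ∀ i j, ‖(Bᴴ * B) i j - (1 : Matrix (Fin n) (Fin n) ℂ) i j‖ ≤ δ)
    (hδ : 0 ≤ δ) (hη : δ * ∑ i, l i ≤ η) :
    (((1 + η : ℝ) : ℂ) • (1 : Matrix (Fin m) (Fin m) ℂ)
      - B * diagonal (fun j => (l j : ℂ)) * Bᴴ).PosSemidef := by
  refine Matrix.PosSemidef.of_dotProduct_mulVec_nonneg ?_ fun x => ?_
  · refine Matrix.IsHermitian.sub ?_ ?_
    · rw [Matrix.IsHermitian, Matrix.conjTranspose_smul]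
      simp
    · refine Matrix.isHermitian_mul_mul_conjTranspose B ?_
      rw [Matrix.IsHermitian, Matrix.diagonal_conjTranspose]
      congr 1
      ext j
      simp
  set c : Fin n → ℂ := Bᴴ *ᵥ x with hc
  set z : Fin n → ℂ := fun i => l i * c i with hz
  set N : ℝ := ∑ i, ‖x i‖ ^ 2 with hN
  set S : ℝ := ∑ i, l i * ‖c i‖ ^ 2 with hS
  have hstar : star x ᵥ* B = star c := by
    rw [hc, Matrix.star_mulVec, Matrix.conjTranspose_conjTranspose]
  have hzc : diagonal (fun j => (l j : ℂ)) *ᵥ c = z := by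
    ext i
    simp [hz, Matrix.mulVec_diagonal]
  have hquad : star x ⬝ᵥ (B * diagonal (fun j => (l j : ℂ)) * Bᴴ) *ᵥ x = (S : ℂ) := by
    rw [← Matrix.mulVec_mulVec, ← Matrix.mulVec_mulVec, Matrix.dotProduct_mulVec, hstar, ← hc, hzc]
    simp only [dotProduct, Pi.star_apply, hz, hS, RCLike.star_def]
    push_cast
    refine Finset.sum_congr rfl fun i _ => ?_
    rw [← Complex.conj_mul']
    ring
  have hSx : star x ⬝ᵥ (B *ᵥ z) = (S : ℂ) := by
    rw [← hquad, ← Matrix.mulVec_mulVec, ← Matrix.mulVec_mulVec, ← hc, hzc]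
  have hS0 : 0 ≤ S := Finset.sum_nonneg fun i _ => mul_nonneg (hl0 i) (sq_nonneg _)
  have hN0 : 0 ≤ N := Finset.sum_nonneg fun i _ => sq_nonneg _
  have hl : 0 ≤ ∑ i, l i := Finset.sum_nonneg fun i _ => hl0 i
  -- Cauchy–Schwarz on `S = ⟨x, B z⟩`. Bounding `‖B z‖²` by `(1 + η) S` then allows a factor `S` to
  -- be cancelled.
  have hCS : S ^ 2 ≤ N * ∑ i, ‖(B *ᵥ z) i‖ ^ 2 := by
    have h1 : S ≤ ∑ i, ‖x i‖ * ‖(B *ᵥ z) i‖ := by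
      calc S = ‖star x ⬝ᵥ (B *ᵥ z)‖ := by
            rw [hSx, Complex.norm_real, Real.norm_of_nonneg hS0]
        _ ≤ _ := by
            refine (norm_sum_le _ _).trans (le_of_eq ?_)
            simp
    calc S ^ 2 ≤ (∑ i, ‖x i‖ * ‖(B *ᵥ z) i‖) ^ 2 := by gcongr
      _ ≤ _ := Finset.sum_mul_sq_le_sq_mul_sq _ _ _
  have hznorm : ∀ i, ‖z i‖ = l i * ‖c i‖ := fun i => by
    simp [hz, abs_of_nonneg (hl0 i)]
  have hz1 : ∑ i, ‖z i‖ ^ 2 ≤ S := by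
    refine Finset.sum_le_sum fun i _ => ?_
    rw [hznorm, mul_pow]
    exact mul_le_mul_of_nonneg_right (by nlinarith [hl0 i, hl1 i]) (sq_nonneg _)
  -- Weighted Cauchy–Schwarz; it puts `∑ l` rather than the number of columns into the error.
  have hz2 : (∑ i, ‖z i‖) ^ 2 ≤ (∑ i, l i) * S := by
    refine Finset.sum_sq_le_sum_mul_sum_of_sq_le_mul _ (fun i _ => hl0 i)
      (fun i _ => mul_nonneg (hl0 i) (sq_nonneg _)) fun i _ => le_of_eq ?_
    rw [hznorm]
    ring
  have hBz : ∑ i, ‖(B *ᵥ z) i‖ ^ 2 ≤ (1 + η) * S := by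
    have e1 : ((∑ i, ‖(B *ᵥ z) i‖ ^ 2 : ℝ) : ℂ)
        = ((∑ i, ‖z i‖ ^ 2 : ℝ) : ℂ) + star z ⬝ᵥ (Bᴴ * B - 1) *ᵥ z := by
      rw [← dotProduct_star_self_eq, ← dotProduct_star_self_eq, Matrix.sub_mulVec,
        Matrix.one_mulVec, dotProduct_sub, add_sub_cancel, ← Matrix.mulVec_mulVec,
        Matrix.dotProduct_mulVec (star z), ← Matrix.star_mulVec]
    have e2 : ‖star z ⬝ᵥ (Bᴴ * B - 1) *ᵥ z‖ ≤ δ * (∑ i, ‖z i‖) ^ 2 := by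
      rw [sq, Finset.sum_mul_sum, Finset.mul_sum]
      refine (norm_sum_le _ _).trans (Finset.sum_le_sum fun i _ => ?_)
      rw [norm_mul, Pi.star_apply, norm_star, Finset.mul_sum]
      calc _ ≤ ‖z i‖ * ∑ j, δ * ‖z j‖ := by
            refine mul_le_mul_of_nonneg_left ?_ (norm_nonneg _)
            refine (norm_sum_le Finset.univ fun j => (Bᴴ * B - 1 : Matrix (Fin n) (Fin n) ℂ) i j * z j).trans
              (Finset.sum_le_sum fun j _ => ?_)
            rw [norm_mul]
            exact mul_le_mul_of_nonneg_right (hB i j) (norm_nonneg _)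
        _ = _ := by
            rw [Finset.mul_sum]
            exact Finset.sum_congr rfl fun j _ => by ring
    have e3 : ∑ i, ‖(B *ᵥ z) i‖ ^ 2 ≤ ∑ i, ‖z i‖ ^ 2 + ‖star z ⬝ᵥ (Bᴴ * B - 1) *ᵥ z‖ := by
      have := congrArg Complex.re e1
      rw [Complex.add_re, Complex.ofReal_re, Complex.ofReal_re] at this
      rw [this]
      gcongr
      exact Complex.re_le_norm _
    have e4 : δ * (∑ i, ‖z i‖) ^ 2 ≤ η * S := by
      calc _ ≤ δ * ((∑ i, l i) * S) := by gcongr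
        _ = (δ * ∑ i, l i) * S := by ring
        _ ≤ _ := by gcongr
    linarith
  have hη0 : 0 ≤ η := le_trans (mul_nonneg hδ hl) hη
  have hfin : S ≤ (1 + η) * N := by
    rcases hS0.eq_or_lt with h | h
    · rw [← h]
      positivity
    · refine le_of_mul_le_mul_right ?_ h
      calc S * S = S ^ 2 := (sq S).symm
        _ ≤ N * ((1 + η) * S) := hCS.trans (by gcongr)
        _ = _ := by ring
  rw [Matrix.sub_mulVec, dotProduct_sub, hquad, Matrix.smul_mulVec, Matrix.one_mulVec,
    dotProduct_smul, dotProduct_star_self_eq, smul_eq_mul, ← Complex.ofReal_mul,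
    ← Complex.ofReal_sub]
  exact_mod_cast sub_nonneg.2 hfin

-- The last clause is the source of the rank dependence: only nonzero eigenvalues contribute to the
-- sum, each at most `1`.
open Matrix in
theorem Matrix.PosSemidef.exists_unitary_diagonal {n : ℕ} {A : Matrix (Fin n) (Fin n) ℂ}
    (hA : A.PosSemidef) : ∃ (U : Matrix (Fin n) (Fin n) ℂ) (p : Fin n → ℝ),
      Uᴴ * U = 1 ∧ U * Uᴴ = 1 ∧ A = U * diagonal (fun j => (p j : ℂ)) * Uᴴ ∧ (∀ i, 0 ≤ p i) ∧
      A.trace = ((∑ i, p i : ℝ) : ℂ) ∧ ((1 - A).PosSemidef → ∀ i, p i ≤ 1) ∧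
      ((1 - A).PosSemidef → ∑ i, p i ≤ A.rank) := by
  have hU := hA.1.eigenvectorUnitary.2
  set U : Matrix (Fin n) (Fin n) ℂ := hA.1.eigenvectorUnitary.1 with hUdef
  have h1 : Uᴴ * U = 1 := (Unitary.mem_iff.1 hU).1
  have h2 : U * Uᴴ = 1 := (Unitary.mem_iff.1 hU).2
  have hspec : A = U * diagonal (fun j => (hA.1.eigenvalues j : ℂ)) * Uᴴ := by
    have := hA.1.spectral_theorem
    rw [Unitary.conjStarAlgAut_apply] at this
    exact this
  have hle : (1 - A).PosSemidef → ∀ i, hA.1.eigenvalues i ≤ 1 := by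
    intro h i
    have h3 := (h.conjTranspose_mul_mul_same U).diag_nonneg (i := i)
    have h4 : Uᴴ * (1 - A) * U = 1 - diagonal (fun j => (hA.1.eigenvalues j : ℂ)) := by
      have : Uᴴ * A * U = diagonal (fun j => (hA.1.eigenvalues j : ℂ)) := by
        conv_lhs => rw [hspec]
        calc _ = (Uᴴ * U) * diagonal (fun j => (hA.1.eigenvalues j : ℂ)) * (Uᴴ * U) := by
              simp only [Matrix.mul_assoc]
          _ = _ := by rw [h1, Matrix.one_mul, Matrix.mul_one]
      rw [Matrix.mul_sub, Matrix.sub_mul, Matrix.mul_one, h1, this]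
    rw [h4] at h3
    simp only [Matrix.sub_apply, Matrix.one_apply_eq, Matrix.diagonal_apply_eq] at h3
    have h5 : (0 : ℂ) ≤ ((1 - hA.1.eigenvalues i : ℝ) : ℂ) := by
      push_cast
      exact h3
    linarith [Complex.zero_le_real.1 h5]
  refine ⟨U, hA.1.eigenvalues, h1, h2, hspec, hA.eigenvalues_nonneg, ?_, hle, fun h => ?_⟩
  · rw [hA.1.trace_eq_sum_eigenvalues]
    push_cast
    rfl
  · rw [hA.1.rank_eq_card_non_zero_eigs, Fintype.card_subtype, Finset.card_filter]
    push_cast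
    refine Finset.sum_le_sum fun i _ => ?_
    split_ifs with h0
    · exact hle h i
    · simp only [not_not] at h0
      exact h0.le

/-! ### Error estimates and the compression. -/

/-- Factor `‖a‖² - ‖b‖²`: the difference of norms is at most `δ` and their sum at most `2 + δ ≤ 3`.
The weights `p` sum to one, so only `∑ l` remains. -/
theorem abs_weighted_sum_norm_sq_sub_le {m n : ℕ} (p : Fin m → ℝ) (l : Fin n → ℝ)
    (a b : Fin m → Fin n → ℂ) (hp : ∀ i, 0 ≤ p i) (hp1 : ∑ i, p i = 1) (hl : ∀ j, 0 ≤ l j)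
    (hb : ∀ i j, ‖b i j‖ ≤ 1) {δ : ℝ} (hδ : δ ≤ 1)
    (hab : ∀ i j, ‖a i j - b i j‖ ≤ δ) :
    |(∑ i, ∑ j, p i * l j * ‖a i j‖ ^ 2) - ∑ i, ∑ j, p i * l j * ‖b i j‖ ^ 2|
      ≤ 3 * (δ * ∑ j, l j) := by
  have hterm : ∀ i j, |‖a i j‖ ^ 2 - ‖b i j‖ ^ 2| ≤ 3 * δ := by
    intro i j
    have h1 := (abs_norm_sub_norm_le (a i j) (b i j)).trans (hab i j)
    rw [sq_sub_sq, abs_mul, abs_of_nonneg (by positivity : 0 ≤ ‖a i j‖ + ‖b i j‖)]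
    have h2 := (abs_le.1 h1).2
    have h3 := hb i j
    exact mul_le_mul (by linarith) h1 (abs_nonneg _) (by norm_num)
  rw [← Finset.sum_sub_distrib]
  simp_rw [← Finset.sum_sub_distrib, ← mul_sub]
  calc _ ≤ ∑ i, ∑ j, |p i * l j * (‖a i j‖ ^ 2 - ‖b i j‖ ^ 2)| :=
        (Finset.abs_sum_le_sum_abs _ _).trans
          (Finset.sum_le_sum fun i _ => Finset.abs_sum_le_sum_abs _ _)
    _ ≤ ∑ i, ∑ j, p i * l j * (3 * δ) := by
        refine Finset.sum_le_sum fun i _ => Finset.sum_le_sum fun j _ => ?_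
        rw [abs_mul, abs_of_nonneg (mul_nonneg (hp i) (hl j))]
        exact mul_le_mul_of_nonneg_left (hterm i j) (mul_nonneg (hp i) (hl j))
    _ = 3 * (δ * ∑ j, l j) := by
        simp_rw [← Finset.sum_mul, ← Finset.mul_sum]
        rw [← Finset.sum_mul, hp1]
        ring

/-- Accounts for both normalisations: the denominator lies between `1 - η ^ 2` and `(1 + η) ^ 2`,
which costs a further `2 * η` beyond the `3 * η` of the numerator. -/
theorem abs_div_sub_le_of_approx {T T₀ τ δ η : ℝ} (hT : |T - T₀| ≤ 3 * η) (h0 : 0 ≤ T)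
    (h1 : T₀ ≤ 1) (hτ : |τ - 1| ≤ δ) (hδη : δ ≤ η) (hη : η ≤ 1 / 5) :
    |T / (τ * (1 + η)) - T₀| ≤ 5 * η := by
  obtain ⟨hT1, hT2⟩ := abs_le.1 hT
  obtain ⟨hτ1, hτ2⟩ := abs_le.1 hτ
  have hη0 : 0 ≤ η := ((abs_nonneg _).trans hτ).trans hδη
  have hτ0 : 0 < τ := by linarith
  have hpos : 0 < τ * (1 + η) := by positivity
  have hlow : 1 - η ^ 2 ≤ τ * (1 + η) := by nlinarith
  have hupp : τ * (1 + η) ≤ (1 + η) ^ 2 := by nlinarith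
  have hT₀ : -(3 * η) ≤ T₀ := by linarith
  rw [abs_le]
  constructor
  -- For small `T₀` the lower bound is nonpositive and positivity suffices; otherwise `T₀ - 5 * η`
  -- is nonnegative and can multiply inequalities.
  · rcases le_total T₀ (5 * η) with h | h
    · have : 0 ≤ T / (τ * (1 + η)) := by positivity
      linarith
    · have : T₀ - 5 * η ≤ T / (τ * (1 + η)) := by
        rw [le_div_iff₀ hpos]
        have h2 : (T₀ - 5 * η) * (τ * (1 + η)) ≤ (T₀ - 5 * η) * (1 + η) ^ 2 := by
          apply mul_le_mul_of_nonneg_left hupp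
          linarith
        have h3 : (T₀ - 5 * η) * (2 * η + η ^ 2) ≤ (1 - 5 * η) * (2 * η + η ^ 2) := by
          gcongr
        have h4 : (1 - 5 * η) * (2 * η + η ^ 2) ≤ 2 * η := by
          nlinarith [mul_nonneg hη0 hη0, mul_nonneg (mul_nonneg hη0 hη0) hη0]
        nlinarith
      linarith
  · have : T / (τ * (1 + η)) ≤ T₀ + 5 * η := by
      rw [div_le_iff₀ hpos]
      have h2 : (T₀ + 5 * η) * (1 - η ^ 2) ≤ (T₀ + 5 * η) * (τ * (1 + η)) := by
        apply mul_le_mul_of_nonneg_left hlow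
        linarith
      have h3 : η ^ 2 * (T₀ + 5 * η) ≤ η ^ 2 * (1 + 5 * η) := by gcongr
      nlinarith [mul_nonneg hη0 hη0]
    linarith

open Matrix in
theorem sum_norm_sq_row_of_unitary {n : ℕ} {U : Matrix (Fin n) (Fin n) ℂ} (hU : U * Uᴴ = 1)
    (i : Fin n) : ∑ j, ‖U i j‖ ^ 2 = 1 := by
  have h := congrFun (congrFun hU i) i
  rw [Matrix.mul_apply, Matrix.one_apply_eq] at h
  simp only [Matrix.conjTranspose_apply, RCLike.star_def, Complex.mul_conj'] at h
  exact_mod_cast h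

open Matrix in
/-- Finitely many states and finitely many effects of rank at most `r` can be compressed to
dimension `d`, changing the probabilities by at most `ε`. -/
theorem exists_compression {X Y : Type*} [Fintype X] [Fintype Y] {d D r : ℕ} (hd : 1 ≤ d)
    (hr : 1 ≤ r) (ρ : X → Matrix (Fin D) (Fin D) ℂ) (F : Y → Matrix (Fin D) (Fin D) ℂ)
    (hρ : ∀ x, IsDensityMatrix (ρ x)) (hF : ∀ y, (F y).PosSemidef)
    (hF1 : ∀ y, (1 - F y).PosSemidef) (hrank : ∀ y, (F y).rank ≤ r) {ε : ℝ} (hε : 0 < ε)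
    (hε1 : ε ≤ 1)
    (hcard : 16 * (((Fintype.card X : ℝ) + Fintype.card Y) * D) ^ 2
      < Real.exp (d * (ε / (40 * r)) ^ 2 / 256)) :
    ∃ (ρ' : X → Matrix (Fin d) (Fin d) ℂ) (F' : Y → Matrix (Fin d) (Fin d) ℂ),
      (∀ x, IsDensityMatrix (ρ' x)) ∧ (∀ y, (F' y).PosSemidef) ∧
      (∀ y, (1 - F' y).PosSemidef) ∧
      ∀ x y, |(ρ' x * F' y).trace.re - (ρ x * F y).trace.re| ≤ ε := by
  have hr1 : (1 : ℝ) ≤ r := by exact_mod_cast hr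
  choose U p hU1 hU2 hρU hp0 hptr _ _ using fun x => (hρ x).1.exists_unitary_diagonal
  choose V l hV1 hV2 hFV hl0 _ hl1 hlr using fun y => (hF y).exists_unitary_diagonal
  have hp1 : ∀ x, ∑ i, p x i = 1 := fun x => by
    have := hptr x
    rw [(hρ x).2] at this
    exact_mod_cast this.symm
  have hls : ∀ y, ∑ i, l y i ≤ r := fun y =>
    (hlr y (hF1 y)).trans (by exact_mod_cast hrank y)
  -- Eight times the accuracy `ε / (40 * r)` requested of `G`. Then `δ * r = ε / 5 = η`, and the
  -- final error `5 * η` is `ε`.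
  set δ : ℝ := ε / (5 * r) with hδ
  have hδ0 : 0 < δ := by positivity
  have hδε : δ ≤ ε / 5 := by
    rw [hδ]
    gcongr
    linarith
  have hδr : δ * r = ε / 5 := by
    rw [hδ]
    field_simp
  obtain ⟨G, hG⟩ := exists_matrix_conjTranspose_mul_approx (C := X ⊕ Y) hd (Sum.elim U V)
    (by rintro (x | y) <;> simp [hU1, hV1]) (δ := ε / (40 * r)) (by positivity)
    (by rw [div_le_one (by positivity)]; linarith)
    (by simpa only [Fintype.card_sum, Nat.cast_add] using hcard)
  have h8 : 8 * (ε / (40 * r)) = δ := by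
    rw [hδ]
    field_simp
    norm_num
  rw [h8] at hG
  have hρG : ∀ x, G * ρ x * Gᴴ = (G * U x) * diagonal (fun j => (p x j : ℂ)) * (G * U x)ᴴ := by
    intro x
    conv_lhs => rw [hρU x]
    simp only [Matrix.conjTranspose_mul, Matrix.mul_assoc]
  have hFG : ∀ y, G * F y * Gᴴ = (G * V y) * diagonal (fun j => (l y j : ℂ)) * (G * V y)ᴴ := by
    intro y
    conv_lhs => rw [hFV y]
    simp only [Matrix.conjTranspose_mul, Matrix.mul_assoc]
  set η : ℝ := ε / 5 with hη
  have hη0 : 0 < η := by positivity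
  let τ : X → ℝ := fun x => (G * ρ x * Gᴴ).trace.re
  have hρpos : ∀ x, (G * ρ x * Gᴴ).PosSemidef := fun x => (hρ x).1.mul_mul_conjTranspose_same G
  have hτ : ∀ x, (G * ρ x * Gᴴ).trace = (τ x : ℂ) := fun x =>
    Complex.eq_re_of_ofReal_le (r := 0) (by simpa using (hρpos x).trace_nonneg)
  have hτ1 : ∀ x, |τ x - 1| ≤ δ := by
    intro x
    have h1 : ((τ x - 1 : ℝ) : ℂ)
        = ∑ j, (p x j : ℂ) * (((G * U x)ᴴ * (G * U x)) j j - ((U x)ᴴ * U x) j j) := by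
      simp_rw [mul_sub]
      rw [Finset.sum_sub_distrib, ← Matrix.trace_mul_diagonal_mul_conjTranspose, ← hρG, hτ, hU1]
      simp only [Matrix.one_apply_eq, mul_one]
      rw [← Complex.ofReal_sum, hp1]
      simp
    rw [← Real.norm_eq_abs, ← Complex.norm_real, h1]
    calc _ ≤ ∑ j, p x j * δ := by
          refine (norm_sum_le _ _).trans (Finset.sum_le_sum fun j _ => ?_)
          rw [norm_mul, Complex.norm_real, Real.norm_of_nonneg (hp0 x j)]
          exact mul_le_mul_of_nonneg_left (hG (Sum.inl x) (Sum.inl x) j j) (hp0 x j)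
      _ = δ := by rw [← Finset.sum_mul, hp1, one_mul]
  have hτ0 : ∀ x, 0 < τ x := fun x => by linarith [(abs_le.1 (hτ1 x)).1]
  -- Dividing by `τ x` restores trace one; dividing by `1 + η` brings the effect back below the
  -- identity.
  refine ⟨fun x => (((τ x)⁻¹ : ℝ) : ℂ) • (G * ρ x * Gᴴ),
    fun y => (((1 + η)⁻¹ : ℝ) : ℂ) • (G * F y * Gᴴ), fun x => ⟨?_, ?_⟩, fun y => ?_, fun y => ?_,
    fun x y => ?_⟩
  · exact (hρpos x).smul (Complex.zero_le_real.2 (inv_nonneg.2 (hτ0 x).le))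
  · rw [Matrix.trace_smul, hτ, smul_eq_mul, ← Complex.ofReal_mul, inv_mul_cancel₀ (hτ0 x).ne',
      Complex.ofReal_one]
  · exact ((hF y).mul_mul_conjTranspose_same G).smul
      (Complex.zero_le_real.2 (by positivity))
  · have h := Matrix.posSemidef_sub_mul_diagonal_mul_conjTranspose (G * V y) (l y) (hl0 y)
      (hl1 y (hF1 y)) (δ := δ) (η := η) (fun i j => by
        have := hG (Sum.inr y) (Sum.inr y) i j
        simp only [Sum.elim_inr, hV1] at this
        exact this) hδ0.le (by
        rw [← hδr]
        exact mul_le_mul_of_nonneg_left (hls y) hδ0.le)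
    rw [← hFG] at h
    have h2 := h.smul (a := (((1 + η)⁻¹ : ℝ) : ℂ)) (Complex.zero_le_real.2 (by positivity))
    rw [smul_sub, smul_smul, ← Complex.ofReal_mul, inv_mul_cancel₀ (by positivity),
      Complex.ofReal_one, one_smul] at h2
    exact h2
  · set T : ℝ := ∑ i, ∑ j, p x i * l y j * ‖((G * U x)ᴴ * (G * V y)) i j‖ ^ 2 with hT
    set T₀ : ℝ := ∑ i, ∑ j, p x i * l y j * ‖((U x)ᴴ * V y) i j‖ ^ 2 with hT₀
    have e0 : (ρ x * F y).trace.re = T₀ := by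
      conv_lhs => rw [hρU x, hFV y]
      rw [Matrix.trace_mul_diagonal_conj_mul_diagonal_conj, Complex.ofReal_re]
    have e1 : ((((τ x)⁻¹ : ℝ) : ℂ) • (G * ρ x * Gᴴ)
        * (((1 + η)⁻¹ : ℝ) : ℂ) • (G * F y * Gᴴ)).trace.re = T / (τ x * (1 + η)) := by
      rw [Matrix.smul_mul, Matrix.mul_smul, Matrix.trace_smul, Matrix.trace_smul, hρG, hFG,
        Matrix.trace_mul_diagonal_conj_mul_diagonal_conj, smul_eq_mul, smul_eq_mul,
        ← Complex.ofReal_mul, ← Complex.ofReal_mul, Complex.ofReal_re, ← hT, div_eq_mul_inv,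
        mul_inv]
      ring
    have hrow : ∀ i, ∑ j, ‖((U x)ᴴ * V y) i j‖ ^ 2 = 1 := by
      refine sum_norm_sq_row_of_unitary ?_
      rw [Matrix.conjTranspose_mul, Matrix.conjTranspose_conjTranspose, Matrix.mul_assoc,
        ← Matrix.mul_assoc (V y), hV2, Matrix.one_mul, hU1]
    have hb : ∀ i j, ‖((U x)ᴴ * V y) i j‖ ≤ 1 := by
      intro i j
      rw [← sq_le_one_iff₀ (norm_nonneg _), ← hrow i]
      exact Finset.single_le_sum (f := fun j => ‖((U x)ᴴ * V y) i j‖ ^ 2)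
        (fun _ _ => sq_nonneg _) (Finset.mem_univ j)
    have hTT : |T - T₀| ≤ 3 * η := by
      refine (abs_weighted_sum_norm_sq_sub_le (p x) (l y) _ _ (hp0 x) (hp1 x) (hl0 y) hb
        (by linarith) fun i j => hG (Sum.inl x) (Sum.inr y) i j).trans ?_
      rw [← hδr]
      have := hls y
      gcongr
    have hT0 : 0 ≤ T := Finset.sum_nonneg fun i _ => Finset.sum_nonneg fun j _ =>
      mul_nonneg (mul_nonneg (hp0 x i) (hl0 y j)) (sq_nonneg _)
    have hT1 : T₀ ≤ 1 := by
      calc T₀ ≤ ∑ i, ∑ j, p x i * ‖((U x)ᴴ * V y) i j‖ ^ 2 := by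
            refine Finset.sum_le_sum fun i _ => Finset.sum_le_sum fun j _ => ?_
            refine mul_le_mul_of_nonneg_right ?_ (sq_nonneg _)
            exact mul_le_of_le_one_right (hp0 x i) (hl1 y (hF1 y) j)
        _ = 1 := by simp_rw [← Finset.mul_sum, hrow, mul_one, hp1]
    rw [e0, e1]
    refine (abs_div_sub_le_of_approx hTT hT0 hT1 (hτ1 x) hδε (by linarith)).trans ?_
    linarith

/-! ### Protocols and the main theorem. -/

namespace OneWayProtocol

variable {n m d : ℕ}

theorem outputProb_not (P : OneWayProtocol n m d) (x : Fin n → Bool) (y : Fin m → Bool)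
    (a : Bool) : P.outputProb x y (!a) = 1 - P.outputProb x y a := by
  have h : P.povm y (!a) = 1 - P.povm y a := by
    cases a <;> simp [povm]
  rw [outputProb, outputProb, h, Matrix.mul_sub, Matrix.mul_one, Matrix.trace_sub,
    (P.isDensityMatrix_ρ x).2, Complex.sub_re, Complex.one_re]

theorem posSemidef_povm (P : OneWayProtocol n m d) (y : Fin m → Bool) (a : Bool) :
    (P.povm y a).PosSemidef := by
  cases a
  · simpa [povm] using P.posSemidef_one_sub_E y
  · simpa [povm] using P.posSemidef_E y

theorem posSemidef_one_sub_povm (P : OneWayProtocol n m d) (y : Fin m → Bool) (a : Bool) :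
    (1 - P.povm y a).PosSemidef := by
  cases a
  · simpa [povm] using P.posSemidef_E y
  · simpa [povm] using P.posSemidef_one_sub_E y

theorem outputProb_nonneg (P : OneWayProtocol n m d) (x : Fin n → Bool) (y : Fin m → Bool)
    (a : Bool) : 0 ≤ P.outputProb x y a := by
  obtain ⟨U, p, -, -, hU, hp, -⟩ := (P.isDensityMatrix_ρ x).1.exists_unitary_diagonal
  obtain ⟨V, l, -, -, hV, hl, -⟩ := (P.posSemidef_povm y a).exists_unitary_diagonal
  rw [outputProb, hU, hV, Matrix.trace_mul_diagonal_conj_mul_diagonal_conj, Complex.ofReal_re]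
  exact Finset.sum_nonneg fun i _ => Finset.sum_nonneg fun j _ =>
    mul_nonneg (mul_nonneg (hp i) (hl j)) (sq_nonneg _)

theorem outputProb_le_one (P : OneWayProtocol n m d) (x : Fin n → Bool) (y : Fin m → Bool)
    (a : Bool) : P.outputProb x y a ≤ 1 := by
  linarith [P.outputProb_not x y a, P.outputProb_nonneg x y (!a)]

/-- The protocol with states `ρ` in which Bob's effect for the output `b y` is `F y`. -/
def ofEffect (ρ : (Fin n → Bool) → Matrix (Fin d) (Fin d) ℂ)
    (F : (Fin m → Bool) → Matrix (Fin d) (Fin d) ℂ) (b : (Fin m → Bool) → Bool)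
    (hρ : ∀ x, IsDensityMatrix (ρ x)) (hF : ∀ y, (F y).PosSemidef)
    (hF1 : ∀ y, (1 - F y).PosSemidef) : OneWayProtocol n m d where
  ρ := ρ
  E y := if b y then F y else 1 - F y
  isDensityMatrix_ρ := hρ
  posSemidef_E y := by
    split_ifs
    exacts [hF y, hF1 y]
  posSemidef_one_sub_E y := by
    split_ifs
    · exact hF1 y
    · simpa using hF y

theorem ofEffect_outputProb (ρ : (Fin n → Bool) → Matrix (Fin d) (Fin d) ℂ)
    (F : (Fin m → Bool) → Matrix (Fin d) (Fin d) ℂ) (b : (Fin m → Bool) → Bool)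
    (hρ : ∀ x, IsDensityMatrix (ρ x)) (hF : ∀ y, (F y).PosSemidef)
    (hF1 : ∀ y, (1 - F y).PosSemidef) (x : Fin n → Bool) (y : Fin m → Bool) :
    (ofEffect ρ F b hρ hF hF1).outputProb x y (b y) = (ρ x * F y).trace.re := by
  have h : (ofEffect ρ F b hρ hF hF1).povm y (b y) = F y := by
    cases hb : b y <;> simp [povm, ofEffect, hb]
  rw [outputProb, h]
  rfl

theorem exists_rank_povm_le_maxMinRank (P : OneWayProtocol n m d) (y : Fin m → Bool) :
    ∃ z, (P.povm y z).rank ≤ P.maxMinRank := by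
  obtain ⟨z, -, hz⟩ := Finset.exists_mem_eq_inf' Finset.univ_nonempty
    fun z : Bool => (P.povm y z).rank
  exact ⟨z, hz ▸ Finset.le_sup' (fun y : Fin m → Bool =>
    Finset.univ.inf' Finset.univ_nonempty fun z : Bool => (P.povm y z).rank) (Finset.mem_univ y)⟩

/-- Two protocols whose probabilities of one output per `y` are close have close errors. -/
theorem ComputesWithError.of_abs_sub_le {D : ℕ} {P : OneWayProtocol n m D}
    {Q : OneWayProtocol n m d} {f : (Fin n → Bool) → (Fin m → Bool) → Bool} {ε₀ ε₁ : ℝ}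
    (hP : P.ComputesWithError f ε₀) (b : (Fin m → Bool) → Bool)
    (h : ∀ x y, |Q.outputProb x y (b y) - P.outputProb x y (b y)| ≤ ε₁) :
    Q.ComputesWithError f (ε₀ + ε₁) := by
  intro x y
  have h1 := abs_le.1 (h x y)
  have h2 := hP x y
  -- The controlled output `b y` is either the wrong answer or the right one; the latter case passes
  -- to the complementary probability.
  by_cases hb : b y = !f x y
  · rw [← hb] at h2 ⊢
    linarith [h1.2]
  · have hb' : f x y = b y := by
      revert hb
      cases b y <;> cases f x y <;> simp
    rw [hb', outputProb_not] at h2 ⊢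
    linarith [h1.1]

end OneWayProtocol

theorem isDensityMatrix_single {d : ℕ} (i : Fin d) :
    IsDensityMatrix (Matrix.diagonal (Pi.single i (1 : ℂ))) := by
  refine ⟨Matrix.PosSemidef.diagonal fun j => ?_, by simp⟩
  by_cases h : j = i
  · subst h
    simp
  · simp [h]

theorem mainTheorem5 (n m D d : ℕ) (hd : 1 ≤ d)
    (f : (Fin n → Bool) → (Fin m → Bool) → Bool)
    (P : OneWayProtocol n m D) (ε₀ ε₁ : ℝ) (hε₁ : 0 < ε₁)
    (hP : P.ComputesWithError f ε₀)
    (hdim : 1280000 * (P.maxMinRank : ℝ) ^ 2 / ε₁ ^ 2 *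
        max (Real.log (4 * ((2 : ℝ) ^ n + (2 : ℝ) ^ (m + 1)) * (D : ℝ)))
          (P.maxMinRank : ℝ) ≤ (d : ℝ)) :
    ∃ Q : OneWayProtocol n m d, Q.ComputesWithError f (ε₀ + ε₁) := by
  have hσ := isDensityMatrix_single (⟨0, hd⟩ : Fin d)
  choose b hb using P.exists_rank_povm_le_maxMinRank
  -- Error probabilities are nonnegative, so `ε₀ ≥ 0`, and for `ε₁ ≥ 1` any protocol will do.
  rcases le_total 1 ε₁ with h1 | h1
  · refine ⟨.ofEffect (fun _ => _) (fun _ => 0) b (fun _ => hσ) (fun _ => Matrix.PosSemidef.zero)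
      (fun _ => by simpa using Matrix.PosSemidef.one), fun x y => ?_⟩
    have h2 := (P.outputProb_nonneg x y _).trans (hP x y)
    exact (OneWayProtocol.outputProb_le_one _ x y _).trans (by linarith)
  -- In rank zero every selected effect vanishes, so Bob's output is determined by `y` and any state
  -- can be sent.
  rcases Nat.eq_zero_or_pos P.maxMinRank with hr | hr
  · refine ⟨.ofEffect (fun _ => _) (fun _ => 0) b (fun _ => hσ) (fun _ => Matrix.PosSemidef.zero)
      (fun _ => by simpa using Matrix.PosSemidef.one), hP.of_abs_sub_le b fun x y => ?_⟩
    have h0 : P.povm y (b y) = 0 := by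
      have hrk : (P.povm y (b y)).rank = 0 := Nat.le_zero.1 (hr ▸ hb y)
      obtain ⟨V, l, -, -, hV, hl, -, -, hs⟩ := (P.posSemidef_povm y (b y)).exists_unitary_diagonal
      have hs' := hs (P.posSemidef_one_sub_povm y (b y))
      rw [hrk, Nat.cast_zero] at hs'
      have hl0 : ∀ j, l j = 0 := fun j =>
        (Finset.sum_eq_zero_iff_of_nonneg fun i _ => hl i).1
          (le_antisymm hs' (Finset.sum_nonneg fun i _ => hl i)) j (Finset.mem_univ j)
      rw [hV]
      simp [hl0]
    rw [OneWayProtocol.ofEffect_outputProb, OneWayProtocol.outputProb, h0]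
    simpa using hε₁.le
  have hD : 1 ≤ D := by
    rcases Nat.eq_zero_or_pos D with h | h
    · subst h
      have := (P.isDensityMatrix_ρ fun _ => false).2
      simp [Matrix.trace] at this
    · exact h
  have hD1 : (1 : ℝ) ≤ D := by exact_mod_cast hD
  have hr1 : (1 : ℝ) ≤ P.maxMinRank := by exact_mod_cast hr
  set r := P.maxMinRank with hrdef
  set N : ℝ := 4 * ((2 : ℝ) ^ n + (2 : ℝ) ^ (m + 1)) * (D : ℝ) with hN
  have hn1 : (1 : ℝ) ≤ 2 ^ n := one_le_pow₀ (by norm_num)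
  have hm1 : (1 : ℝ) ≤ 2 ^ m := one_le_pow₀ (by norm_num)
  have hN1 : 1 < N := by
    rw [hN, pow_succ]
    nlinarith
  have hL : 0 < Real.log N := Real.log_pos hN1
  have hbound : 1280000 * (r : ℝ) ^ 2 / ε₁ ^ 2 * Real.log N ≤ d :=
    le_trans (by gcongr; exact le_max_left _ _) hdim
  obtain ⟨ρ', F', h1', h2', h3', h4'⟩ := exists_compression hd hr P.ρ (fun y => P.povm y (b y))
    P.isDensityMatrix_ρ (fun y => P.posSemidef_povm y _) (fun y => P.posSemidef_one_sub_povm y _)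
    hb hε₁ h1 (by
      simp only [Fintype.card_pi, Fintype.card_bool, Finset.prod_const, Finset.card_univ,
        Fintype.card_fin]
      push_cast
      calc 16 * (((2 : ℝ) ^ n + 2 ^ m) * D) ^ 2 = (4 * (2 ^ n + 2 ^ m) * D) ^ 2 := by ring
        _ ≤ N ^ 2 := by
            have : (2 : ℝ) ^ m ≤ 2 ^ (m + 1) := by
              rw [pow_succ]
              linarith
            rw [hN]
            gcongr
        _ = Real.exp (2 * Real.log N) := by
            rw [two_mul, Real.exp_add, Real.exp_log (by linarith), sq]
        _ < _ := by
            rw [Real.exp_lt_exp]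
            -- `3.125 = 1280000 / (40² * 256)`; a factor above `2` is needed because the cardinality
            -- condition is bounded by `N ^ 2`.
            calc 2 * Real.log N < 3.125 * Real.log N := by linarith
              _ = (1280000 * (r : ℝ) ^ 2 / ε₁ ^ 2 * Real.log N) * (ε₁ / (40 * r)) ^ 2 / 256 := by
                  field_simp
                  norm_num
              _ ≤ _ := by gcongr)
  refine ⟨.ofEffect ρ' F' b h1' h2' h3', hP.of_abs_sub_le b fun x y => ?_⟩
  rw [OneWayProtocol.ofEffect_outputProb]
  exact h4' x y
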